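/- Let $G$ be a group of finite exponent, that is, there is a positive integer $n$ with $g^n=1$ for all $g\in G$. Suppose that $G$ has a finite identity basis: there is a finite set $W$ of group words such that $w=1$ holds identically in $G$ for every $w\in W$, and every identity of $G$ holds in every group that satisfies all the identities $w=1$, $w\in W$. Let $I$ be any set with at least two elements, and let $B(G,I)=(I\times G\times I)\cup\{0\}$ be the Brandt semigroup over $G$ with index set $I$, with multiplication $(i,g,j)(k,h,\ell)=(i,gh,\ell)$ if $j=k$, $(i,g,j)(k,h,\ell)=0$ if $j\neq k$, and $0x=x0=0$ for all $x$. Then the plain identities of $B(G,I)$ have a finite basis: there is a finite set $\Sigma$ of identities $u=v$ between semigroup words (non-empty products of variables) such that all identities in $\Sigma$ hold in $B(G,I)$, and every identity between semigroup words that holds in $B(G,I)$ holds in every semigroup satisfying all identities in $\Sigma$. -/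

import Mathlib

/-! ### Plain (semigroup) identities

Plain words are elements of the free semigroup over the countable alphabet `ℕ`; an identity
`u = v` is a pair of plain words. -/

/-- A plain identity `u = v`, encoded as the pair `(u, v)` of its sides. -/
abbrev PlainIdentity : Type := FreeSemigroup ℕ × FreeSemigroup ℕ

/-- The semigroup `S` satisfies the plain identity `e`: both sides take the same value under
every evaluation of the variables in `S`. -/
def PlainIdentity.HoldsIn (e : PlainIdentity) (S : Type*) [Semigroup S] : Prop :=
  ∀ f : ℕ → S, FreeSemigroup.lift f e.1 = FreeSemigroup.lift f e.2

/-- `e` is a consequence of the set `E`: every semigroup satisfying all identities in `E`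
satisfies `e`. Restricting to semigroups in `Type` is harmless, see `plainEntails_iff`. -/
def PlainEntails (E : Set PlainIdentity) (e : PlainIdentity) : Prop :=
  ∀ (T : Type) [Semigroup T], (∀ d ∈ E, d.HoldsIn T) → e.HoldsIn T

/-- `E` is a basis of the plain identities of `S`: all its members hold in `S`, and every plain
identity of `S` is a consequence of `E`. -/
def IsPlainIdentityBasis (E : Set PlainIdentity) (S : Type*) [Semigroup S] : Prop :=
  (∀ e ∈ E, e.HoldsIn S) ∧ ∀ e : PlainIdentity, e.HoldsIn S → PlainEntails E e

/-- The plain identities of `S` have a finite basis. -/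
def HasFinitePlainIdentityBasis (S : Type*) [Semigroup S] : Prop :=
  ∃ E : Set PlainIdentity, E.Finite ∧ IsPlainIdentityBasis E S

theorem FreeSemigroup.lift_comp_hom {S T : Type*} [Semigroup S] [Semigroup T]
    (φ : S →ₙ* T) (f : ℕ → S) (w : FreeSemigroup ℕ) :
    φ (FreeSemigroup.lift f w) = FreeSemigroup.lift (φ ∘ f) w := by
  have h : φ.comp (FreeSemigroup.lift f) = FreeSemigroup.lift (φ ∘ f) := by
    apply FreeSemigroup.hom_ext
    funext x
    simp
  exact DFunLike.congr_fun h w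

/-- Consequence does not depend on the universe in which semigroups are taken. -/
theorem plainEntails_iff.{w} (E : Set PlainIdentity) (e : PlainIdentity) :
    PlainEntails E e ↔
      ∀ (T : Type w) [Semigroup T], (∀ d ∈ E, d.HoldsIn T) → e.HoldsIn T := by
  constructor
  · intro h T _ hT f
    let c : Con (FreeSemigroup ℕ) := Con.ker (FreeSemigroup.lift f)
    let φ : c.Quotient →ₙ* T :=
      { toFun := Quotient.lift (FreeSemigroup.lift f) (fun _ _ hab => hab)
        map_mul' := by
          rintro ⟨a⟩ ⟨b⟩
          exact map_mul (FreeSemigroup.lift f) a b }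
    have hφ : Function.Injective φ := by
      rintro ⟨a⟩ ⟨b⟩ hab
      exact Quotient.sound hab
    have hq := h c.Quotient (fun d hd g => hφ (by
      rw [FreeSemigroup.lift_comp_hom, FreeSemigroup.lift_comp_hom]
      exact hT d hd _)) (fun n => (FreeSemigroup.of n : FreeSemigroup ℕ))
    have hq' := congrArg φ hq
    rw [FreeSemigroup.lift_comp_hom, FreeSemigroup.lift_comp_hom] at hq'
    have hf : (φ ∘ fun n => ((FreeSemigroup.of n : FreeSemigroup ℕ) : c.Quotient)) = f := by
      funext n
      exact FreeSemigroup.lift_of f n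
    rwa [hf] at hq'
  · intro h T _ hT f
    have hinj : Function.Injective (MulEquiv.ulift.{0, w} (α := T)).symm :=
      MulEquiv.injective _
    have key := h (ULift.{w} T) (fun d hd g => by
      have := hT d hd (ULift.down ∘ g)
      apply (MulEquiv.ulift.{0, w} (α := T)).injective
      have h1 := FreeSemigroup.lift_comp_hom
        ((MulEquiv.ulift.{0, w} (α := T)) : ULift.{w} T →ₙ* T) g
      exact (h1 d.1).trans (this.trans (h1 d.2).symm)) (ULift.up ∘ f)
    have h1 := FreeSemigroup.lift_comp_hom
      ((MulEquiv.ulift.{0, w} (α := T)) : ULift.{w} T →ₙ* T) (ULift.up ∘ f)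
    exact (h1 e.1).symm.trans ((congrArg _ key).trans (h1 e.2))

/-! ### Group identities

Every group identity `u = v` is equivalent to `u * v⁻¹ = 1`, so a group identity `w = 1` is
encoded by the element `w` of the free group over the countable alphabet `ℕ`. -/

/-- The group `G` satisfies the identity `w = 1`. -/
def GroupIdentityHolds (w : FreeGroup ℕ) (G : Type*) [Group G] : Prop :=
  ∀ f : ℕ → G, FreeGroup.lift f w = 1

/-- `w = 1` is a consequence of the identities `d = 1` with `d ∈ W`: every group satisfying the
latter satisfies the former. Restricting to groups in `Type` is harmless, see
`groupEntails_iff`. -/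
def GroupEntails (W : Set (FreeGroup ℕ)) (w : FreeGroup ℕ) : Prop :=
  ∀ (H : Type) [Group H], (∀ d ∈ W, GroupIdentityHolds d H) → GroupIdentityHolds w H

/-- `{d = 1 : d ∈ W}` is an identity basis of the group `G`. -/
def IsGroupIdentityBasis (W : Set (FreeGroup ℕ)) (G : Type*) [Group G] : Prop :=
  (∀ w ∈ W, GroupIdentityHolds w G) ∧
    ∀ w : FreeGroup ℕ, GroupIdentityHolds w G → GroupEntails W w

/-- The group `G` has a finite identity basis. -/
def HasFiniteGroupIdentityBasis (G : Type*) [Group G] : Prop :=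
  ∃ W : Set (FreeGroup ℕ), W.Finite ∧ IsGroupIdentityBasis W G

theorem FreeGroup.lift_comp_hom {G H : Type*} [Group G] [Group H]
    (φ : G →* H) (f : ℕ → G) (w : FreeGroup ℕ) :
    φ (FreeGroup.lift f w) = FreeGroup.lift (φ ∘ f) w := by
  have h : φ.comp (FreeGroup.lift f) = FreeGroup.lift (φ ∘ f) := by
    ext x
    simp
  exact DFunLike.congr_fun h w

/-- Consequence does not depend on the universe in which groups are taken. -/
theorem groupEntails_iff.{w} (W : Set (FreeGroup ℕ)) (v : FreeGroup ℕ) :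
    GroupEntails W v ↔
      ∀ (H : Type w) [Group H], (∀ d ∈ W, GroupIdentityHolds d H) → GroupIdentityHolds v H := by
  constructor
  · intro h H _ hH f
    let φ := QuotientGroup.kerLift (FreeGroup.lift f)
    have hφ : Function.Injective φ := QuotientGroup.kerLift_injective _
    have hq := h (FreeGroup ℕ ⧸ (FreeGroup.lift f).ker) (fun d hd g => hφ (by
      rw [FreeGroup.lift_comp_hom, map_one]
      exact hH d hd _)) (fun n => (FreeGroup.of n : FreeGroup ℕ))
    have hq' := congrArg φ hq
    rw [FreeGroup.lift_comp_hom, map_one] at hq'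
    have hf : (φ ∘ fun n => ((FreeGroup.of n : FreeGroup ℕ) :
        FreeGroup ℕ ⧸ (FreeGroup.lift f).ker)) = f := by
      funext n
      exact FreeGroup.lift_apply_of
    rwa [hf] at hq'
  · intro h H _ hH f
    have key := h (ULift.{w} H) (fun d hd g => by
      apply (MulEquiv.ulift.{0, w} (α := H)).injective
      have h1 := FreeGroup.lift_comp_hom
        ((MulEquiv.ulift.{0, w} (α := H)) : ULift.{w} H →* H) g d
      exact h1.trans (hH d hd _)) (ULift.up ∘ f)
    have h1 := FreeGroup.lift_comp_hom
      ((MulEquiv.ulift.{0, w} (α := H)) : ULift.{w} H →* H) (ULift.up ∘ f) v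
    exact h1.symm.trans (congrArg _ key)

/-! ### Brandt semigroups -/

/-- The underlying set `(I × G × I) ∪ {0}` of the Brandt semigroup `B(G, I)` with structure group
`G` and index set `I`. -/
inductive BrandtSemigroup (G I : Type*) where
  /-- the added zero -/
  | zero : BrandtSemigroup G I
  /-- the triple `(i, g, j)` -/
  | triple (i : I) (g : G) (j : I) : BrandtSemigroup G I

namespace BrandtSemigroup

open Classical in
/-- `(i, g, j)(k, h, l) = (i, gh, l)` if `j = k`, and all other products are `0`. -/
protected noncomputable def mul {G I : Type*} [Group G] :
    BrandtSemigroup G I → BrandtSemigroup G I → BrandtSemigroup G I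
  | triple i g j, triple k h l => if j = k then triple i (g * h) l else zero
  | zero, _ => zero
  | triple _ _ _, zero => zero

noncomputable instance {G I : Type*} [Group G] : Semigroup (BrandtSemigroup G I) where
  mul := BrandtSemigroup.mul
  mul_assoc a b c := by
    change BrandtSemigroup.mul (BrandtSemigroup.mul a b) c =
      BrandtSemigroup.mul a (BrandtSemigroup.mul b c)
    rcases a with _ | ⟨i, g, j⟩
    · rfl
    rcases b with _ | ⟨k, h, l⟩
    · rfl
    rcases c with _ | ⟨p, q, r⟩
    · by_cases h1 : j = k <;> simp [BrandtSemigroup.mul, h1]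
    · by_cases h1 : j = k <;> by_cases h2 : l = p <;>
        simp [BrandtSemigroup.mul, h1, h2, mul_assoc]

end BrandtSemigroup

/-! Read the letters of a word as edges labelled by elements of `G`. If no letter is sent to zero,
the value in `B(G, I)` is nonzero exactly when the word is a walk. So the sides of an identity are
walks in the same graphs, two vertices being enough, and have equal products in `G` (`BrandtEquiv`).
In `brandtBasis` three identities make letters periodic and idempotents commute; the others encode
`W`.

Let `M` be a semigroup satisfying the basis with an identity adjoined, and let `u`, `v` be
equivalent words. A bridge of `u` is a bridge of `v`, with equivalent parts on both sides
(`BrandtEquiv.exists_bridge`), so induction on length leaves words without bridges. Such a `u` has a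
regular value `a = a a' a` (`isRegularElem_prod_of_forall_not_bridge`). Put `e = a a'`. A cut `u =
u₁ u₂` gives `p = e u₁` and `q = u₂ a'` with `p q = e`, and the idempotent `q p` serves as a vertex.
Commuting idempotents and periodicity show that the vertices before and after a letter depend on the
letter alone (`IsVertex.unique`, `IsPeriodicLetter.vertex_pow`). So `u` is a walk on these vertices,
hence so is `v`, and along it the letters become units of `e M e`. These units form a group
satisfying the identities of `G`, whence `u = e v` in `M` (`BrandtEquiv.prod_eq_mul_prod`). By
symmetry `v = f u`, and commutation of `e` and `f` gives `u = v`. -/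

/-! ### Walks

A plain word is read as a walk in the directed graph whose edges are the variables. -/

/-- The word, read along edges `x : s x ⟶ t x`, is a walk from the first to the second vertex. -/
def Walk {J : Type*} (s t : ℕ → J) : List ℕ → J → J → Prop
  | [], i, j => i = j
  | x :: l, i, j => s x = i ∧ Walk s t l (t x) j

namespace Walk

variable {J : Type*} {s t s' t' : ℕ → J}

theorem append_iff {l₁ l₂ : List ℕ} {i k : J} :
    Walk s t (l₁ ++ l₂) i k ↔ ∃ j, Walk s t l₁ i j ∧ Walk s t l₂ j k := by
  induction l₁ generalizing i with
  | nil => simp [Walk]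
  | cons x l ih => simp [Walk, ih, and_assoc]

theorem congr {l : List ℕ} (h : ∀ x ∈ l, s x = s' x ∧ t x = t' x) {i j : J} :
    Walk s t l i j ↔ Walk s' t' l i j := by
  induction l generalizing i with
  | nil => rfl
  | cons x l ih =>
    simp only [List.mem_cons, forall_eq_or_imp] at h
    simp only [Walk, h.1, ih h.2]

theorem loop {l : List ℕ} {i : J} (h : ∀ x ∈ l, s x = i ∧ t x = i) : Walk s t l i i := by
  induction l with
  | nil => rfl
  | cons x l ih =>
    simp only [List.mem_cons, forall_eq_or_imp] at h
    refine ⟨h.1.1, ?_⟩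
    rw [h.1.2]
    exact ih h.2

theorem source_eq_of_mem {l : List ℕ} {i j : J} (h : ∀ x, s x = i → t x = i)
    (hw : Walk s t l i j) : ∀ x ∈ l, s x = i := by
  induction l with
  | nil => simp
  | cons x l ih =>
    simp only [List.mem_cons, forall_eq_or_imp]
    have hw' := hw.2
    rw [h x hw.1] at hw'
    exact ⟨hw.1, ih hw'⟩

theorem map {K : Type*} (χ : J → K) {l : List ℕ} {i j : J} (hw : Walk s t l i j) :
    Walk (χ ∘ s) (χ ∘ t) l (χ i) (χ j) := by
  induction l generalizing i with
  | nil => exact congrArg χ hw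
  | cons x l ih => exact ⟨congrArg χ hw.1, ih hw.2⟩

/-- Indicator functions separate vertices, so two-vertex graphs detect all walks. -/
theorem of_forall_bool {l : List ℕ} {i j : J}
    (h : ∀ χ : J → Bool, Walk (χ ∘ s) (χ ∘ t) l (χ i) (χ j)) : Walk s t l i j := by
  classical
  have eq_of {a b : J} (hab : ∀ χ : J → Bool, χ a = χ b) : a = b := by
    simpa using hab (fun c => decide (c = b))
  induction l generalizing i with
  | nil => exact eq_of h
  | cons x l ih => exact ⟨eq_of fun χ => (h χ).1, ih fun χ => (h χ).2⟩

/-- If `x` is the only edge leading out of the vertex `false`, then a walk from `false` to `true`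
passes `x`. -/
theorem exists_eq_append_cons {s t : ℕ → Bool} {x : ℕ}
    (hx : ∀ y, s y = false → t y = true → y = x) (ht : ∀ y, s y = true → t y = true)
    {l : List ℕ} (hw : Walk s t l false true) :
    ∃ l₁ l₂, l = l₁ ++ x :: l₂ ∧ (∀ y ∈ l₁, s y = false ∧ t y = false) ∧
      ∀ y ∈ l₂, s y = true := by
  induction l with
  | nil => exact absurd hw (by simp [Walk])
  | cons y l ih =>
    obtain ⟨hs, hw⟩ := hw
    cases hy : t y with
    | false =>
      rw [hy] at hw
      obtain ⟨l₁, l₂, rfl, h₁, h₂⟩ := ih hw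
      refine ⟨y :: l₁, l₂, rfl, ?_, h₂⟩
      simp only [List.mem_cons, forall_eq_or_imp]
      exact ⟨⟨hs, hy⟩, h₁⟩
    | true =>
      rw [hy] at hw
      obtain rfl := hx y hs hy
      exact ⟨[], l, rfl, by simp, source_eq_of_mem ht hw⟩

end Walk

/-! ### Equivalent words -/

/-- Two words are walks of the same two-vertex graphs and have the same values in `G`. For
nonempty words this says that they form an identity of the Brandt semigroups over `G`. -/
structure BrandtEquiv (G : Type*) [Group G] (l l' : List ℕ) : Prop where
  walk_iff (s t : ℕ → Bool) (i j : Bool) : Walk s t l i j ↔ Walk s t l' i j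
  prod_eq (g : ℕ → G) : (l.map g).prod = (l'.map g).prod

theorem List.prod_map_eq_one {M : Type*} [Monoid M] {l : List ℕ} {g : ℕ → M}
    (h : ∀ x ∈ l, g x = 1) : (l.map g).prod = 1 :=
  List.prod_eq_one (by simpa using h)

theorem List.prod_map_congr {M : Type*} [Monoid M] {l : List ℕ} {g g' : ℕ → M}
    (h : ∀ x ∈ l, g x = g' x) : (l.map g).prod = (l.map g').prod := by
  rw [List.map_congr_left h]

namespace BrandtEquiv

variable {G : Type*} [Group G] {l l' : List ℕ}

theorem symm (h : BrandtEquiv G l l') : BrandtEquiv G l' l :=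
  ⟨fun s t i j => (h.walk_iff s t i j).symm, fun g => (h.prod_eq g).symm⟩

theorem walk {J : Type*} (h : BrandtEquiv G l l') {s t : ℕ → J} {i j : J}
    (hw : Walk s t l i j) : Walk s t l' i j :=
  Walk.of_forall_bool fun χ => (h.walk_iff _ _ _ _).1 (hw.map χ)

theorem mem (h : BrandtEquiv G l l') {x : ℕ} (hx : x ∈ l) : x ∈ l' := by
  by_contra hx'
  -- Test graph: `x` leads from `false` to `true`, every other letter is a loop at `true`.
  have hw : Walk (fun y => decide (y ≠ x)) (fun _ => true) l' true true :=
    Walk.loop fun y hy => ⟨by simp [ne_of_mem_of_not_mem hy hx'], rfl⟩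
  simpa using Walk.source_eq_of_mem (fun _ _ => rfl) ((h.walk_iff _ _ _ _).2 hw) x hx

/-- Turning all letters outside `P` into loops at `j` extends the walk over the whole word; on the
other side the loop `x` forces the prefix to end at `j`. -/
theorem prefix_walk {P : ℕ → Prop} {x : ℕ} {l₁ l₂ l₁' l₂' : List ℕ}
    (h : BrandtEquiv G (l₁ ++ x :: l₂) (l₁' ++ x :: l₂')) (h₁ : ∀ y ∈ l₁, P y)
    (h₁' : ∀ y ∈ l₁', P y) (hx : ¬ P x) (h₂ : ∀ y ∈ l₂, ¬ P y)
    {s t : ℕ → Bool} {i j : Bool} (hw : Walk s t l₁ i j) : Walk s t l₁' i j := by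
  classical
  let s' : ℕ → Bool := fun y => if P y then s y else j
  let t' : ℕ → Bool := fun y => if P y then t y else j
  have key : Walk s' t' (l₁' ++ x :: l₂') i j := by
    refine h.walk (Walk.append_iff.2 ⟨j, (Walk.congr ?_).1 hw, Walk.loop ?_⟩)
    · intro y hy
      simp [s', t', h₁ y hy]
    · simp only [List.mem_cons, forall_eq_or_imp]
      refine ⟨by simp [s', t', hx], fun y hy => by simp [s', t', h₂ y hy]⟩
  obtain ⟨k, hk, hsx, -⟩ := Walk.append_iff.1 key
  obtain rfl : j = k := by simpa [s', hx] using hsx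
  refine (Walk.congr ?_).1 hk
  intro y hy
  simp [s', t', h₁' y hy]

theorem suffix_walk {P : ℕ → Prop} {x : ℕ} {l₁ l₂ l₁' l₂' : List ℕ}
    (h : BrandtEquiv G (l₁ ++ x :: l₂) (l₁' ++ x :: l₂')) (h₁ : ∀ y ∈ l₁, ¬ P y)
    (hx : ¬ P x) (h₂ : ∀ y ∈ l₂, P y) (h₂' : ∀ y ∈ l₂', P y)
    {s t : ℕ → Bool} {i j : Bool} (hw : Walk s t l₂ i j) : Walk s t l₂' i j := by
  classical
  let s' : ℕ → Bool := fun y => if P y then s y else i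
  let t' : ℕ → Bool := fun y => if P y then t y else i
  have hx' : s' x = i ∧ t' x = i := by simp [s', t', hx]
  have key : Walk s' t' (l₁' ++ x :: l₂') i j := by
    refine h.walk (Walk.append_iff.2 ⟨i, Walk.loop ?_, hx'.1, ?_⟩)
    · intro y hy
      simp [s', t', h₁ y hy]
    · rw [hx'.2]
      refine (Walk.congr ?_).1 hw
      intro y hy
      simp [s', t', h₂ y hy]
  obtain ⟨k, -, -, hw'⟩ := Walk.append_iff.1 key
  rw [hx'.2] at hw'
  refine (Walk.congr ?_).1 hw'
  intro y hy
  simp [s', t', h₂' y hy]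

/-- Equivalent words decompose in the same way along a letter `x` such that the parts before and
after `x` and `x` itself have no common letters. -/
theorem exists_bridge {x : ℕ} {l₁ l₂ : List ℕ} (h : BrandtEquiv G (l₁ ++ x :: l₂) l')
    (hx₁ : x ∉ l₁) (hx₂ : x ∉ l₂) (hd : ∀ y ∈ l₁, y ∉ l₂) :
    ∃ l₁' l₂', l' = l₁' ++ x :: l₂' ∧ BrandtEquiv G l₁ l₁' ∧ BrandtEquiv G l₂ l₂' := by
  classical
  -- Letters of `l₁` are loops at `false`, `x` is the only edge from `false` to `true`, and all
  -- other letters are loops at `true`.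
  let s : ℕ → Bool := fun y => decide (y ∉ l₁ ∧ y ≠ x)
  let t : ℕ → Bool := fun y => decide (y ∉ l₁)
  have hw : Walk s t (l₁ ++ x :: l₂) false true := by
    refine Walk.append_iff.2 ⟨false, Walk.loop ?_, by simp [s], ?_⟩
    · intro y hy
      simp [s, t, hy]
    · rw [show t x = true by simpa [t] using hx₁]
      refine Walk.loop fun y hy => ?_
      have h1 : y ∉ l₁ := fun hy' => hd y hy' hy
      have h2 : y ≠ x := fun hyx => hx₂ (hyx ▸ hy)
      simp [s, t, h1, h2]
  obtain ⟨l₁', l₂', rfl, h₁', h₂'⟩ := Walk.exists_eq_append_cons (x := x)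
    (by simp only [s, t, decide_eq_false_iff_not, decide_eq_true_eq]; tauto)
    (by simp only [s, t, decide_eq_true_eq]; tauto) (h.walk hw)
  simp only [s, t, decide_eq_false_iff_not, decide_eq_true_eq, not_not] at h₁' h₂'
  have m₁ : ∀ y ∈ l₁', y ∈ l₁ := fun y hy => (h₁' y hy).2
  have m₂ : ∀ y ∈ l₂', y ∈ l₂ := fun y hy => by
    have := h.symm.mem (x := y) (by simp [hy])
    simp only [List.mem_append, List.mem_cons] at this
    rcases this with h3 | h3 | h3
    · exact absurd h3 (h₂' y hy).1
    · exact absurd h3 (h₂' y hy).2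
    · exact h3
  refine ⟨l₁', l₂', rfl, ⟨fun s t i j => ⟨?_, ?_⟩, fun g => ?_⟩,
    ⟨fun s t i j => ⟨?_, ?_⟩, fun g => ?_⟩⟩
  · exact h.prefix_walk (P := (· ∈ l₁)) (fun _ => id) m₁ hx₁ fun y hy hy' => hd y hy' hy
  · exact h.symm.prefix_walk (P := (· ∈ l₁)) m₁ (fun _ => id) hx₁
      fun y hy hy' => hd y hy' (m₂ y hy)
  -- Sending the letters outside `l₁` to `1` isolates the products of the prefixes.
  · have := h.prod_eq fun y => if y ∈ l₁ then g y else 1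
    simp only [List.map_append, List.prod_append, List.map_cons, List.prod_cons, hx₁,
      if_false, one_mul] at this
    rw [List.prod_map_congr (g' := g) (by simp +contextual),
      List.prod_map_congr (l := l₁') (g' := g) (fun y hy => by simp [m₁ y hy]),
      List.prod_map_eq_one (l := l₂) (fun y hy => if_neg fun hy' => hd y hy' hy),
      List.prod_map_eq_one (l := l₂') (fun y hy => if_neg fun hy' => hd y hy' (m₂ y hy))] at this
    simpa using this
  · exact h.suffix_walk (P := (· ∈ l₂)) hd hx₂ (fun _ => id) m₂
  · exact h.symm.suffix_walk (P := (· ∈ l₂)) (fun y hy => hd y (m₁ y hy)) hx₂ m₂ (fun _ => id)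
  · have := h.prod_eq fun y => if y ∈ l₂ then g y else 1
    simp only [List.map_append, List.prod_append, List.map_cons, List.prod_cons, hx₂,
      if_false, one_mul] at this
    rw [List.prod_map_eq_one (l := l₁) (fun y hy => if_neg (hd y hy)),
      List.prod_map_eq_one (l := l₁') (fun y hy => if_neg (hd y (m₁ y hy))),
      List.prod_map_congr (l := l₂) (g' := g) (by simp +contextual),
      List.prod_map_congr (l := l₂') (g' := g) (fun y hy => by simp [m₂ y hy])] at this
    simpa using this

theorem eq_nil (h : BrandtEquiv G [] l') : l' = [] := by
  by_contra hne
  obtain ⟨x, hx⟩ := List.exists_mem_of_ne_nil l' hne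
  simpa using h.symm.mem hx

end BrandtEquiv

/-! ### Regular elements of monoids with commuting idempotents -/

/-- Von Neumann regularity of an element of a monoid. -/
def IsRegularElem {M : Type*} [Monoid M] (a : M) : Prop :=
  ∃ b, a * b * a = a

section Regular

variable {M : Type*} [Monoid M]

theorem IsRegularElem.one : IsRegularElem (1 : M) :=
  ⟨1, by simp⟩

theorem IsRegularElem.mul
    (hcomm : ∀ e f : M, IsIdempotentElem e → IsIdempotentElem f → Commute e f) {a b : M}
    (ha : IsRegularElem a) (hb : IsRegularElem b) : IsRegularElem (a * b) := by
  obtain ⟨a', ha⟩ := ha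
  obtain ⟨b', hb⟩ := hb
  refine ⟨b' * a', ?_⟩
  have h₁ : IsIdempotentElem (a' * a) := by
    rw [IsIdempotentElem, mul_assoc, ← mul_assoc a, ha]
  have h₂ : IsIdempotentElem (b * b') := by
    rw [IsIdempotentElem, ← mul_assoc, hb]
  calc a * b * (b' * a') * (a * b) = a * ((b * b') * (a' * a)) * b := by simp only [mul_assoc]
    _ = a * ((a' * a) * (b * b')) * b := by rw [(hcomm _ _ h₂ h₁).eq]
    _ = (a * a' * a) * (b * b' * b) := by simp only [mul_assoc]
    _ = a * b := by rw [ha, hb]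

theorem IsRegularElem.exists_inverse {a : M} (h : IsRegularElem a) :
    ∃ b, a * b * a = a ∧ b * a * b = b := by
  obtain ⟨b, hb⟩ := h
  refine ⟨b * a * b, ?_, ?_⟩
  · calc a * (b * a * b) * a = (a * b * a) * b * a := by simp only [mul_assoc]
      _ = a := by rw [hb, hb]
  · calc b * a * b * a * (b * a * b) = b * ((a * b * a) * b * a) * b := by simp only [mul_assoc]
      _ = b * a * b := by rw [hb, hb]

/-- The letter `x` satisfies the identity `x y x = (x y) ^ (n + 1) x`. -/
def IsPeriodicLetter (n : ℕ) (x : M) : Prop :=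
  ∀ y, x * y * x = (x * y) ^ (n + 1) * x

theorem IsPeriodicLetter.pow_mul_eq {n : ℕ} {x : M} (hx : IsPeriodicLetter n x) (y : M) :
    (x * y) ^ n * (x * y * x) = x * y * x := by
  conv_rhs => rw [hx y]
  rw [pow_succ]
  simp only [mul_assoc]

/-- For `n ≥ 2` the power `(x y) ^ n` begins with `x y x`, on which `(x y) ^ n` acts as a left
identity. -/
theorem IsPeriodicLetter.isIdempotentElem_pow {n : ℕ} (hn : 2 ≤ n) {x : M}
    (hx : IsPeriodicLetter n x) (y : M) : IsIdempotentElem ((x * y) ^ n) := by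
  obtain ⟨k, rfl⟩ := Nat.exists_eq_add_of_le hn
  have h := congrArg (· * (y * (x * y) ^ k)) (hx.pow_mul_eq y)
  have h2 : (x * y) ^ (2 + k) = x * y * x * (y * (x * y) ^ k) := by
    rw [pow_add, pow_two]
    simp only [mul_assoc]
  rwa [mul_assoc, ← h2] at h

/-- Serves a cut between `p` and `q` in a factor `x p q x`: inserting `(x p q) ^ n` in front keeps
the value and makes the part before the cut regular. -/
theorem IsPeriodicLetter.isRegularElem {n : ℕ} (hn : 2 ≤ n) {x : M}
    (hx : IsPeriodicLetter n x) (p q : M) : IsRegularElem ((x * p * q) ^ n * (x * p)) := by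
  have hi := hx.isIdempotentElem_pow hn (p * q)
  rw [← mul_assoc] at hi
  refine ⟨q * (x * p * q) ^ (n - 1), ?_⟩
  have h : (x * p) * (q * (x * p * q) ^ (n - 1)) = (x * p * q) ^ n := by
    rw [← mul_assoc, mul_pow_sub_one (by omega)]
  calc _ = (x * p * q) ^ n * ((x * p) * (q * (x * p * q) ^ (n - 1))) *
      ((x * p * q) ^ n * (x * p)) := by simp only [mul_assoc]
    _ = _ := by rw [h, hi.eq, ← mul_assoc, hi.eq]

theorem IsPeriodicLetter.isRegularElem_mul_mul {n : ℕ} (hn : 2 ≤ n) {x : M}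
    (hx : IsPeriodicLetter n x) (y : M) : IsRegularElem (x * y * x) := by
  obtain ⟨k, rfl⟩ := Nat.exists_eq_add_of_le hn
  refine ⟨y * (x * y) ^ k, ?_⟩
  conv_rhs => rw [← hx.pow_mul_eq y, pow_add, pow_two]
  simp only [mul_assoc]

/-- A word in periodic letters without bridges has a regular value. -/
theorem isRegularElem_prod_of_forall_not_bridge
    (hcomm : ∀ e f : M, IsIdempotentElem e → IsIdempotentElem f → Commute e f)
    {n : ℕ} (hn : 2 ≤ n) {F : ℕ → M} (hF : ∀ x, IsPeriodicLetter n (F x)) {l : List ℕ}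
    (hl : ∀ l₁ x l₂, l = l₁ ++ x :: l₂ → x ∉ l₁ → x ∉ l₂ → ∃ y ∈ l₁, y ∈ l₂) :
    IsRegularElem (l.map F).prod := by
  -- Stronger claim for the induction: any prefix can be replaced by a regular element without
  -- changing the value of the whole word.
  suffices h : ∀ (k : ℕ) (l₁ l₂ : List ℕ), l₁.length = k → l = l₁ ++ l₂ →
      ∃ r, IsRegularElem r ∧ (l.map F).prod = r * (l₂.map F).prod by
    obtain ⟨r, hr, h⟩ := h _ l [] rfl (by simp)
    simpa [h] using hr
  intro k
  induction k using Nat.strong_induction_on with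
  | _ k ih =>
  rintro l₁ l₂ rfl h
  rcases l₁.eq_nil_or_concat with rfl | ⟨l₁, z, rfl⟩
  · exact ⟨1, .one, by simp [h]⟩
  rw [List.concat_eq_append] at h ih
  by_cases hz : z ∈ l₁
  · obtain ⟨α, p, rfl⟩ := List.append_of_mem hz
    obtain ⟨r, hr, hr'⟩ := ih α.length (by simp) α (z :: p ++ [z] ++ l₂) rfl (by simp [h])
    refine ⟨r * (F z * (p.map F).prod * F z), hr.mul hcomm ?_, ?_⟩
    · exact (hF z).isRegularElem_mul_mul hn _
    · rw [hr']
      simp [mul_assoc]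
  -- Since `z` is no bridge, some letter occurs on both sides of the cut after `z`.
  · obtain ⟨x, hx₁, hx₂⟩ : ∃ x ∈ l₁ ++ [z], x ∈ l₂ := by
      by_cases hz' : z ∈ l₂
      · exact ⟨z, by simp, hz'⟩
      · obtain ⟨y, hy, hy'⟩ := hl l₁ z l₂ (by simp [h]) hz hz'
        exact ⟨y, by simp [hy], hy'⟩
    obtain ⟨α, p, hα⟩ := List.append_of_mem hx₁
    obtain ⟨q, β, rfl⟩ := List.append_of_mem hx₂
    rw [hα] at h ih
    obtain ⟨r, hr, hr'⟩ := ih α.length (by simp) α (x :: p ++ (q ++ x :: β)) rfl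
      (by simp [h])
    refine ⟨_, hr.mul hcomm ((hF x).isRegularElem hn (p.map F).prod (q.map F).prod), ?_⟩
    rw [hr']
    have h3 := (hF x).pow_mul_eq ((p.map F).prod * (q.map F).prod)
    simp only [List.map_append, List.prod_append, List.map_cons, List.prod_cons]
    calc r * (F x * (p.map F).prod * ((q.map F).prod * (F x * (β.map F).prod)))
        = r * (F x * ((p.map F).prod * (q.map F).prod) * F x) * (β.map F).prod := by
          simp only [mul_assoc]
      _ = _ := by
          rw [← h3]
          simp only [mul_assoc]

/-! ### The group of units of a local monoid -/

/-- The elements of `e M e` that are invertible there. -/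
@[ext]
structure LocalUnit (e : M) where
  /-- the underlying element -/
  val : M
  /-- the inverse with respect to `e` -/
  inv : M
  left_val : e * val = val
  left_inv : e * inv = inv
  val_inv : val * inv = e
  inv_val : inv * val = e

namespace LocalUnit

variable {e : M}

theorem isIdempotentElem (h : LocalUnit e) : IsIdempotentElem e := by
  rw [IsIdempotentElem]
  nth_rw 2 [← h.val_inv]
  rw [← mul_assoc, h.left_val, h.val_inv]

theorem right_val (h : LocalUnit e) : h.val * e = h.val :=
  calc h.val * e = h.val * (h.inv * h.val) := by rw [h.inv_val]
    _ = h.val := by rw [← mul_assoc, h.val_inv, h.left_val]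

theorem right_inv (h : LocalUnit e) : h.inv * e = h.inv :=
  calc h.inv * e = h.inv * (h.val * h.inv) := by rw [h.val_inv]
    _ = h.inv := by rw [← mul_assoc, h.inv_val, h.left_inv]

theorem val_injective : Function.Injective (val : LocalUnit e → M) := by
  intro g h hgh
  refine LocalUnit.ext hgh ?_
  calc g.inv = h.inv * h.val * g.inv := by rw [h.inv_val, g.left_inv]
    _ = h.inv * (g.val * g.inv) := by rw [hgh, mul_assoc]
    _ = h.inv := by rw [g.val_inv, h.right_inv]

/-- The group structure, for an idempotent `e`. -/
abbrev group (he : IsIdempotentElem e) : Group (LocalUnit e) where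
  mul g h :=
    { val := g.val * h.val
      inv := h.inv * g.inv
      left_val := by rw [← mul_assoc, g.left_val]
      left_inv := by rw [← mul_assoc, h.left_inv]
      val_inv := by rw [mul_assoc, ← mul_assoc h.val, h.val_inv, g.left_inv, g.val_inv]
      inv_val := by rw [mul_assoc, ← mul_assoc g.inv, g.inv_val, h.left_val, h.inv_val] }
  one := ⟨e, e, he, he, he, he⟩
  inv g := ⟨g.inv, g.val, g.left_inv, g.left_val, g.inv_val, g.val_inv⟩
  mul_assoc _ _ _ := val_injective (mul_assoc _ _ _)
  one_mul g := val_injective g.left_val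
  mul_one g := val_injective g.right_val
  inv_mul_cancel g := val_injective g.inv_val

end LocalUnit

/-! ### The vertices of the walk given by a regular product -/

/-- A factorization of the idempotent `e` through the idempotent `q * p`. -/
structure IsVertex (e p q : M) : Prop where
  mul_eq : p * q = e
  left : e * p = p
  right : q * e = q

theorem IsVertex.isIdempotentElem {e p q : M} (h : IsVertex e p q) :
    IsIdempotentElem (q * p) := by
  rw [IsIdempotentElem, mul_assoc, ← mul_assoc p, h.mul_eq, h.left]

/-- By `hk`, `p' q` is a unit of `e M e`. Commuting the two idempotents gives `p' q = (p' q)(p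
q')(p' q)`, so `p q'` is its inverse; then each idempotent absorbs the other. -/
theorem IsVertex.unique
    (hcomm : ∀ e f : M, IsIdempotentElem e → IsIdempotentElem f → Commute e f)
    {e p q p' q' : M} (h : IsVertex e p q) (h' : IsVertex e p' q') {k : ℕ}
    (hk : e * (p' * q) ^ (k + 1) * e = e) : q * p = q' * p' := by
  have hc := (hcomm _ _ h.isIdempotentElem h'.isIdempotentElem).eq
  have hl : e * (p' * q) = p' * q := by rw [← mul_assoc, h'.left]
  have hr : (p' * q) * e = p' * q := by rw [mul_assoc, h.right]
  have h1 : p' * q = p' * q * (p * q') * (p' * q) := by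
    calc p' * q = e * (p' * q) * e := by rw [hl, hr]
      _ = p' * q' * (p' * q) * (p * q) := by rw [h.mul_eq, h'.mul_eq]
      _ = p' * ((q' * p') * (q * p)) * q := by simp only [mul_assoc]
      _ = p' * ((q * p) * (q' * p')) * q := by rw [hc]
      _ = _ := by simp only [mul_assoc]
  have hpow : (p' * q) ^ (k + 1) = e := by
    calc (p' * q) ^ (k + 1) = e * (p' * q) ^ (k + 1) := by rw [pow_succ', ← mul_assoc, hl]
      _ = e * (p' * q) ^ (k + 1) * e := by rw [mul_assoc e, pow_succ, mul_assoc _ _ e, hr]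
      _ = e := hk
  have h2 : (p * q') * (p' * q) = e := by
    calc (p * q') * (p' * q) = e * ((p * q') * (p' * q)) := by simp only [← mul_assoc, h.left]
      _ = (p' * q) ^ k * (p' * q * (p * q') * (p' * q)) := by
        rw [← hpow, pow_succ]; simp only [mul_assoc]
      _ = e := by rw [← h1, ← pow_succ, hpow]
  have h3 : (p' * q) * (p * q') = e := by
    calc (p' * q) * (p * q') = ((p' * q) * (p * q')) * e := by simp only [mul_assoc, h'.right]
      _ = (p' * q * (p * q') * (p' * q)) * (p' * q) ^ k := by
        rw [← hpow, pow_succ']; simp only [mul_assoc]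
      _ = e := by rw [← h1, ← pow_succ', hpow]
  calc q * p = q * ((p * q') * (p' * q)) * p := by rw [h2, h.right]
    _ = ((q * p) * (q' * p')) * (q * p) := by simp only [mul_assoc]
    _ = (q' * p') * (q * p) := by rw [hc, mul_assoc, h.isIdempotentElem.eq]
    _ = (q' * p') * ((q' * p') * (q * p)) := by
      rw [← mul_assoc (q' * p') (q' * p'), h'.isIdempotentElem.eq]
    _ = (q' * p') * ((q * p) * (q' * p')) := by rw [hc]
    _ = q' * ((p' * q) * (p * q')) * p' := by simp only [mul_assoc]
    _ = q' * p' := by rw [h3, h'.right]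

/-- Expand the left `e` as `p (x c)` and the right one as `p' (x c')`. The middle becomes `(x c p')
^ (n + 1) x`, which periodicity collapses to `x c p' x`. -/
theorem IsPeriodicLetter.vertex_pow {n : ℕ} {e x p c p' c' : M} (hx : IsPeriodicLetter n x)
    (h : IsVertex e p (x * c)) (h' : IsVertex e p' (x * c')) :
    e * (p' * (x * c)) ^ n * e = e := by
  have he : e * e = e := by nth_rw 2 [← h.mul_eq]; rw [← mul_assoc, h.left, h.mul_eq]
  calc e * (p' * (x * c)) ^ n * e
      = p * (x * c * (p' * (x * c)) ^ n) * (p' * (x * c')) := by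
        rw [h'.mul_eq, ← mul_assoc p, h.mul_eq]
    _ = p * ((x * (c * p')) ^ (n + 1) * x) * c' := by
        rw [← mul_pow_mul, pow_succ]; simp only [mul_assoc]
    _ = (p * (x * c)) * (p' * (x * c')) := by rw [← hx]; simp only [mul_assoc]
    _ = e := by rw [h.mul_eq, h'.mul_eq, he]

/-- Equivalent words have comparable values if the first value is regular. -/
theorem BrandtEquiv.prod_eq_mul_prod {G : Type*} [Group G] {l l' : List ℕ}
    (h : BrandtEquiv G l l')
    (hcomm : ∀ e f : M, IsIdempotentElem e → IsIdempotentElem f → Commute e f)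
    {n : ℕ} (hn : 2 ≤ n) {F : ℕ → M} (hF : ∀ x, IsPeriodicLetter n (F x))
    {e a' : M} (he : e = (l.map F).prod * a') (ha : e * (l.map F).prod = (l.map F).prod)
    (ha' : a' * e = a')
    (hunit : ∀ he : IsIdempotentElem e, letI := LocalUnit.group he
      ∀ γ : ℕ → LocalUnit e, (l.map γ).prod = (l'.map γ).prod) :
    (l.map F).prod = e * (l'.map F).prod := by
  classical
  have hidem : IsIdempotentElem e := by
    rw [IsIdempotentElem]; nth_rw 2 [he]; rw [← mul_assoc, ha, he]
  let := LocalUnit.group hidem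
  let p (l₁ : List ℕ) : M := e * (l₁.map F).prod
  let q (l₂ : List ℕ) : M := (l₂.map F).prod * a'
  have hq (x r) : q (x :: r) = F x * q r := by simp [q, mul_assoc]
  have hp (x r) : p (r ++ [x]) = p r * F x := by simp [p, mul_assoc]
  have hv (l₁ l₂ : List ℕ) (hl : l = l₁ ++ l₂) : IsVertex e (p l₁) (q l₂) := by
    refine ⟨?_, ?_, ?_⟩
    · calc p l₁ * q l₂ = e * (l.map F).prod * a' := by simp [p, q, hl, mul_assoc]
        _ = e := by rw [ha, he]
    · simp only [p]; rw [← mul_assoc, hidem.eq]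
    · simp only [q]; rw [mul_assoc, ha']
  -- All occurrences of `x` have the same source and target. One power condition serves both, as
  -- moving `x` across the cut does not change `p m₁ * q (x :: l₂)`.
  have hsrc {x : ℕ} {l₁ l₂ m₁ m₂ : List ℕ} (hl : l = l₁ ++ x :: l₂) (hm : l = m₁ ++ x :: m₂) :
      q (x :: l₂) * p l₁ = q (x :: m₂) * p m₁ ∧
        q l₂ * p (l₁ ++ [x]) = q m₂ * p (m₁ ++ [x]) := by
    have h₁ := hv _ _ hl
    have h₂ := hv _ _ hm
    have hpow : e * (p m₁ * q (x :: l₂)) ^ (n - 1 + 1) * e = e := by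
      rw [Nat.sub_add_cancel (by omega)]
      rw [hq] at h₁ h₂ ⊢
      exact (hF x).vertex_pow h₁ h₂
    refine ⟨h₁.unique hcomm h₂ hpow,
      (hv (l₁ ++ [x]) l₂ (by simp [hl])).unique hcomm (hv (m₁ ++ [x]) m₂ (by simp [hm]))
        (k := n - 1) ?_⟩
    rw [hp, mul_assoc (p m₁), ← hq]
    exact hpow
  have hex (x : ℕ) : ∃ st : M × M, ∀ l₁ l₂, l = l₁ ++ x :: l₂ →
      st.1 = q (x :: l₂) * p l₁ ∧ st.2 = q l₂ * p (l₁ ++ [x]) := by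
    by_cases hx : x ∈ l
    · obtain ⟨l₁, l₂, hl⟩ := List.append_of_mem hx
      exact ⟨(_, _), fun m₁ m₂ hm => hsrc hl hm⟩
    · exact ⟨(1, 1), fun m₁ m₂ hm => absurd (by simp [hm]) hx⟩
  choose st hst using hex
  let s (x : ℕ) : M := (st x).1
  let t (x : ℕ) : M := (st x).2
  have hwalk : Walk s t l e (q [] * p l) := by
    have key (l₂ : List ℕ) : ∀ l₁, l = l₁ ++ l₂ → Walk s t l₂ (q l₂ * p l₁) (q [] * p l) := by
      induction l₂ with
      | nil => intro l₁ hl; rw [List.append_nil] at hl; rw [hl]; rfl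
      | cons x r ih =>
        intro l₁ hl
        refine ⟨(hst x _ _ hl).1, ?_⟩
        rw [show t x = _ from (hst x _ _ hl).2]
        exact ih _ (by simp [hl])
    have hw := key l [] rfl
    have h0 : q l * p [] = e := by simp [p, q, ← he, hidem.eq]
    rwa [h0] at hw
  -- One factorization is fixed per vertex, so that the labels of consecutive edges telescope. Off
  -- the walk the value `(1, 1)` is arbitrary.
  have hPQ (f : M) : ∃ pq : M × M, (∃ l₁ l₂, l = l₁ ++ l₂ ∧ f = q l₂ * p l₁) →
      IsVertex e pq.1 pq.2 ∧ pq.2 * pq.1 = f := by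
    by_cases hf : ∃ l₁ l₂, l = l₁ ++ l₂ ∧ f = q l₂ * p l₁
    · obtain ⟨l₁, l₂, hl, rfl⟩ := hf
      exact ⟨(p l₁, q l₂), fun _ => ⟨hv _ _ hl, rfl⟩⟩
    · exact ⟨(1, 1), fun hf' => absurd hf' hf⟩
  choose PQ hPQ using hPQ
  have hγ (x : ℕ) : ∃ γ : LocalUnit e, x ∈ l → IsVertex e (PQ (s x)).1 (PQ (s x)).2 ∧
      (PQ (s x)).2 * (PQ (s x)).1 = s x ∧ IsVertex e (PQ (t x)).1 (PQ (t x)).2 ∧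
      (PQ (t x)).2 * (PQ (t x)).1 = t x ∧ s x * F x = F x * t x ∧
      γ.val = (PQ (s x)).1 * F x * (PQ (t x)).2 := by
    by_cases hx : x ∈ l
    · obtain ⟨l₁, l₂, hl⟩ := List.append_of_mem hx
      obtain ⟨hs, ht⟩ := hst x _ _ hl
      obtain ⟨hvs, hes⟩ := hPQ (s x) ⟨_, _, hl, hs⟩
      obtain ⟨hvt, het⟩ := hPQ (t x) ⟨l₁ ++ [x], l₂, by simp [hl], ht⟩
      have hs' : s x = F x * (q l₂ * p l₁) := by rw [← mul_assoc, ← hq]; exact hs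
      have ht' : t x = (q l₂ * p l₁) * F x := by rw [mul_assoc, ← hp]; exact ht
      have hst₁ : s x * s x = F x * t x * (q l₂ * p l₁) := by
        rw [hs', ht']; simp only [mul_assoc]
      have hts₁ : t x * t x = q l₂ * p l₁ * s x * F x := by
        rw [hs', ht']; simp only [mul_assoc]
      have hsQ : s x * (PQ (s x)).2 = (PQ (s x)).2 := by
        nth_rw 1 [← hes]; rw [mul_assoc, hvs.mul_eq, hvs.right]
      have htQ : t x * (PQ (t x)).2 = (PQ (t x)).2 := by
        nth_rw 1 [← het]; rw [mul_assoc, hvt.mul_eq, hvt.right]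
      -- The inverse runs from the target of `x` through the rest of the word, then `a'`, then the
      -- prefix back to the source.
      refine ⟨⟨(PQ (s x)).1 * F x * (PQ (t x)).2, (PQ (t x)).1 * (q l₂ * p l₁) * (PQ (s x)).2,
        ?_, ?_, ?_, ?_⟩, fun _ => ⟨hvs, hes, hvt, het, ?_, rfl⟩⟩
      · simp only [← mul_assoc, hvs.left]
      · simp only [← mul_assoc, hvt.left]
      · calc _ = (PQ (s x)).1 * (F x * ((PQ (t x)).2 * (PQ (t x)).1) * (q l₂ * p l₁)) *
              (PQ (s x)).2 := by simp only [mul_assoc]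
          _ = (PQ (s x)).1 * (s x * (s x * (PQ (s x)).2)) := by
            rw [het, ← hst₁, mul_assoc, mul_assoc]
          _ = e := by rw [hsQ, hsQ, hvs.mul_eq]
      · calc _ = (PQ (t x)).1 * ((q l₂ * p l₁) * ((PQ (s x)).2 * (PQ (s x)).1) * F x) *
              (PQ (t x)).2 := by simp only [mul_assoc]
          _ = (PQ (t x)).1 * (t x * (t x * (PQ (t x)).2)) := by
            rw [hes, ← hts₁, mul_assoc, mul_assoc]
          _ = e := by rw [htQ, htQ, hvt.mul_eq]
      · rw [hs', ht']; simp only [mul_assoc]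
    · exact ⟨1, fun hx' => absurd hx' hx⟩
  choose γ hγ using hγ
  have heval (w : List ℕ) : ∀ i j, Walk s t w i j → (∀ x ∈ w, x ∈ l) →
      (IsVertex e (PQ i).1 (PQ i).2 ∧ (PQ i).2 * (PQ i).1 = i) →
      i * (w.map F).prod = (PQ i).2 * ((w.map γ).prod).val * (PQ j).1 := by
    induction w with
    | nil =>
      rintro i _ rfl - ⟨hi, hi'⟩
      change i * 1 = (PQ i).2 * e * (PQ i).1
      rw [hi.right, hi', mul_one]
    | cons x w ih =>
      rintro _ j ⟨rfl, hw⟩ hmem -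
      simp only [List.mem_cons, forall_eq_or_imp] at hmem
      obtain ⟨-, hes, hvt, het, hst', hg⟩ := hγ x hmem.1
      have hmul : ((x :: w).map γ).prod.val = (γ x).val * ((w.map γ).prod).val := by
        rw [List.map_cons, List.prod_cons]; rfl
      have htt : t x * (PQ (t x)).2 = (PQ (t x)).2 := by
        nth_rw 1 [← het]; rw [mul_assoc, hvt.mul_eq, hvt.right]
      calc s x * ((x :: w).map F).prod = F x * (t x * (w.map F).prod) := by
            rw [List.map_cons, List.prod_cons, ← mul_assoc, hst', mul_assoc]
        _ = F x * ((PQ (t x)).2 * ((w.map γ).prod).val * (PQ j).1) := by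
            rw [ih _ _ hw hmem.2 ⟨hvt, het⟩]
        _ = (F x * t x) * (PQ (t x)).2 * ((w.map γ).prod).val * (PQ j).1 := by
            rw [mul_assoc (F x), htt]; simp only [mul_assoc]
        _ = ((PQ (s x)).2 * (PQ (s x)).1) * F x * (PQ (t x)).2 * ((w.map γ).prod).val *
              (PQ j).1 := by rw [← hst', hes]
        _ = _ := by rw [hmul, hg]; simp only [mul_assoc]
  have hve := hPQ e ⟨[], l, rfl, by simp [p, q, ← he, hidem.eq]⟩
  rw [heval l' _ _ (h.walk hwalk) (fun _ => h.symm.mem) hve, ← hunit hidem γ,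
    ← heval l _ _ hwalk (fun _ => id) hve, ha]

end Regular

/-! ### Induction along bridges -/

/-- If `x` and the parts of the word before and after `x` have no common letters, then `x` is a
bridge of the graph of the word. -/
def IsBridgeSplit (l₁ : List ℕ) (x : ℕ) (l₂ : List ℕ) : Prop :=
  x ∉ l₁ ∧ x ∉ l₂ ∧ ∀ y ∈ l₁, y ∉ l₂

/-- Equivalent words have the same value in every monoid with commuting idempotents, for
periodic letters, if the local groups satisfy the resulting group identities. -/
theorem BrandtEquiv.prod_map_eq {M : Type*} [Monoid M] {G : Type*} [Group G]
    (hcomm : ∀ e f : M, IsIdempotentElem e → IsIdempotentElem f → Commute e f)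
    {n : ℕ} (hn : 2 ≤ n) {F : ℕ → M} (hF : ∀ x, IsPeriodicLetter n (F x))
    (hne : ∀ x y, F x * y ≠ 1)
    (hunit : ∀ l l', BrandtEquiv G l l' → ∀ e : M, e ≠ 1 → ∀ he : IsIdempotentElem e,
      letI := LocalUnit.group he
      ∀ γ : ℕ → LocalUnit e, (l.map γ).prod = (l'.map γ).prod)
    {l l' : List ℕ} (h : BrandtEquiv G l l') : (l.map F).prod = (l'.map F).prod := by
  induction hk : l.length using Nat.strong_induction_on generalizing l l' with
  | _ k ih =>
  subst hk
  by_cases hb : ∃ l₁ x l₂, l = l₁ ++ x :: l₂ ∧ IsBridgeSplit l₁ x l₂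
  · obtain ⟨l₁, x, l₂, rfl, hx₁, hx₂, hd⟩ := hb
    obtain ⟨l₁', l₂', rfl, h₁, h₂⟩ := h.exists_bridge hx₁ hx₂ hd
    simp only [List.map_append, List.prod_append, List.map_cons, List.prod_cons]
    rw [ih _ (by simp) h₁ rfl, ih _ (by simp; omega) h₂ rfl]
  have hb' : ¬ ∃ l₁ x l₂, l' = l₁ ++ x :: l₂ ∧ IsBridgeSplit l₁ x l₂ := by
    rintro ⟨l₁, x, l₂, rfl, hx₁, hx₂, hd⟩
    obtain ⟨l₁', l₂', rfl, h₁, h₂⟩ := h.symm.exists_bridge hx₁ hx₂ hd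
    exact hb ⟨l₁', x, l₂', rfl, mt h₁.symm.mem hx₁, mt h₂.symm.mem hx₂,
      fun y hy => mt h₂.symm.mem (hd y (h₁.symm.mem hy))⟩
  have key {l l' : List ℕ} (h : BrandtEquiv G l l')
      (hb : ¬ ∃ l₁ x l₂, l = l₁ ++ x :: l₂ ∧ IsBridgeSplit l₁ x l₂) :
      ∃ e, IsIdempotentElem e ∧ (l.map F).prod = e * (l'.map F).prod := by
    -- The empty word is separate because `hunit` excludes `e = 1`; otherwise `e` begins with a
    -- letter and `hne` applies.
    rcases l with _ | ⟨x, r⟩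
    · exact ⟨1, .one, by simp [h.eq_nil]⟩
    obtain ⟨a', h₁, h₂⟩ := (isRegularElem_prod_of_forall_not_bridge hcomm hn hF
      (l := x :: r) (by
        intro l₁ y l₂ hl hy₁ hy₂
        by_contra! hd
        exact hb ⟨l₁, y, l₂, hl, hy₁, hy₂, hd⟩)).exists_inverse
    refine ⟨_, ?_, h.prod_eq_mul_prod hcomm hn hF rfl h₁ (by rw [← mul_assoc, h₂])
      (hunit _ _ h _ ?_)⟩
    · rw [IsIdempotentElem, ← mul_assoc, h₁]
    · rw [List.map_cons, List.prod_cons, mul_assoc]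
      exact hne _ _
  obtain ⟨e, he, h₁⟩ := key h hb
  obtain ⟨f, hf, h₂⟩ := key h.symm hb'
  -- The second value is fixed by `f e = e f`, hence by `e`.
  have hfe : f * (e * (l'.map F).prod) = (l'.map F).prod := by rw [← h₁, ← h₂]
  have h₃ : (l'.map F).prod = e * (l'.map F).prod :=
    calc (l'.map F).prod = f * (e * (l'.map F).prod) := hfe.symm
      _ = e * f * (e * (l'.map F).prod) := by
        rw [(hcomm _ _ he hf).eq, mul_assoc, ← mul_assoc e e, he.eq]
      _ = e * (l'.map F).prod := by rw [mul_assoc, hfe]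
  exact h₁.trans h₃.symm

/-! ### Positive powers in semigroups -/

/-- The power `a ^ (k + 1)` in a semigroup. -/
def succPow {S : Type*} [Semigroup S] (a : S) : ℕ → S
  | 0 => a
  | k + 1 => succPow a k * a

theorem map_succPow {S T : Type*} [Semigroup S] [Semigroup T] (φ : S →ₙ* T) (a : S) (k : ℕ) :
    φ (succPow a k) = succPow (φ a) k := by
  induction k with
  | zero => rfl
  | succ k ih => rw [succPow, map_mul, ih, succPow]

theorem succPow_eq_pow {M : Type*} [Monoid M] (a : M) (k : ℕ) : succPow a k = a ^ (k + 1) := by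
  induction k with
  | zero => simp [succPow]
  | succ k ih => rw [succPow, ih, pow_succ _ (k + 1)]

theorem coe_succPow {S : Type*} [Semigroup S] (a : S) (k : ℕ) :
    ((succPow a k : S) : WithOne S) = (a : WithOne S) ^ (k + 1) := by
  induction k with
  | zero => simp [succPow]
  | succ k ih => rw [succPow, WithOne.coe_mul, ih, pow_succ _ (k + 1)]

/-! ### Evaluation in Brandt semigroups -/

namespace BrandtSemigroup

variable {G I : Type*} [Group G]

@[simp] theorem zero_mul' (a : BrandtSemigroup G I) : zero * a = zero := rfl

@[simp] theorem mul_zero' (a : BrandtSemigroup G I) : a * zero = zero := by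
  cases a <;> rfl

open Classical in
theorem triple_mul_triple (i j k l : I) (g h : G) :
    (triple i g j * triple k h l : BrandtSemigroup G I) =
      if j = k then triple i (g * h) l else zero := rfl

@[simp] theorem triple_mul_triple_same (i j l : I) (g h : G) :
    (triple i g j * triple j h l : BrandtSemigroup G I) = triple i (g * h) l := by
  simp [triple_mul_triple]

theorem triple_mul_triple_of_ne {j k : I} (hjk : j ≠ k) (i l : I) (g h : G) :
    (triple i g j * triple k h l : BrandtSemigroup G I) = zero := by
  simp [triple_mul_triple, hjk]

@[simp] theorem succPow_zero (k : ℕ) : succPow (zero : BrandtSemigroup G I) k = zero := by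
  cases k <;> simp [succPow]

@[simp] theorem succPow_triple_same (i : I) (g : G) (k : ℕ) :
    succPow (triple i g i : BrandtSemigroup G I) k = triple i (g ^ (k + 1)) i := by
  induction k with
  | zero => simp [succPow]
  | succ k ih => rw [succPow, ih, triple_mul_triple_same, pow_succ g (k + 1)]

theorem succPow_triple_of_ne {i j : I} (hij : i ≠ j) (g : G) {k : ℕ} (hk : 0 < k) :
    succPow (triple i g j : BrandtSemigroup G I) k = zero := by
  induction k, hk using Nat.le_induction with
  | base => simp [succPow, triple_mul_triple_of_ne hij.symm]
  | succ k _ ih => rw [succPow, ih, zero_mul']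

/-- A proper power is zero or a power in a maximal subgroup. -/
theorem eq_zero_or_loop (a : BrandtSemigroup G I) :
    (∀ k, 0 < k → succPow a k = zero) ∨ ∃ i g, a = triple i g i := by
  rcases a with _ | ⟨i, g, j⟩
  · exact Or.inl fun k _ => succPow_zero k
  · by_cases hij : i = j
    · subst hij
      exact Or.inr ⟨i, g, rfl⟩
    · exact Or.inl fun k hk => succPow_triple_of_ne hij g hk

theorem prod_eq_triple_iff {f : ℕ → BrandtSemigroup G I} {s t : ℕ → I} {g : ℕ → G}
    (hf : ∀ x, f x = triple (s x) (g x) (t x)) (w : FreeSemigroup ℕ) {i j : I} {c : G} :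
    FreeSemigroup.lift f w = triple i c j ↔
      Walk s t (w.head :: w.tail) i j ∧ ((w.head :: w.tail).map g).prod = c := by
  induction w using FreeSemigroup.recOnMul generalizing i j c with
  | ih1 x =>
    rw [FreeSemigroup.lift_of, hf]
    simp only [FreeSemigroup.of, Walk, triple.injEq, List.map_cons, List.map_nil, List.prod_cons,
      List.prod_nil, mul_one]
    tauto
  | ih2 x w ih1 ih2 =>
    have hl : (FreeSemigroup.of x * w).head :: (FreeSemigroup.of x * w).tail =
      x :: (w.head :: w.tail) := rfl
    rw [map_mul, FreeSemigroup.lift_of, hf, hl, List.map_cons, List.prod_cons]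
    constructor
    · intro h
      rcases hw : FreeSemigroup.lift f w with _ | ⟨i', c', j'⟩
      · simp [hw] at h
      · rw [hw, triple_mul_triple] at h
        split_ifs at h with hi
        obtain ⟨h1, h2, h3⟩ := triple.inj h
        obtain ⟨h4, h5⟩ := ih2.1 hw
        rw [← hi, h3] at h4
        exact ⟨⟨h1, h4⟩, by rw [h5, h2]⟩
    · rintro ⟨⟨rfl, hw⟩, rfl⟩
      rw [ih2.2 ⟨hw, rfl⟩, triple_mul_triple_same]

end BrandtSemigroup

/-- The two sides of an identity of `B(G, I)` are equivalent words. -/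
theorem PlainIdentity.HoldsIn.brandtEquiv {G I : Type*} [Group G] [Nontrivial I]
    {d : PlainIdentity} (h : d.HoldsIn (BrandtSemigroup G I)) :
    BrandtEquiv G (d.1.head :: d.1.tail) (d.2.head :: d.2.tail) := by
  classical
  obtain ⟨a, b, hab⟩ := exists_pair_ne I
  let ι : Bool → I := fun c => if c then a else b
  have hι : Function.Injective ι := by
    rintro (_ | _) (_ | _) <;> simp [ι, hab, hab.symm]
  have hkey (s t : ℕ → I) (g : ℕ → G) (i j : I) (c : G) :
      (Walk s t (d.1.head :: d.1.tail) i j ∧ ((d.1.head :: d.1.tail).map g).prod = c) ↔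
      (Walk s t (d.2.head :: d.2.tail) i j ∧ ((d.2.head :: d.2.tail).map g).prod = c) := by
    have hf (x : ℕ) : (fun x => BrandtSemigroup.triple (s x) (g x) (t x)) x =
      BrandtSemigroup.triple (s x) (g x) (t x) := rfl
    rw [← BrandtSemigroup.prod_eq_triple_iff hf, ← BrandtSemigroup.prod_eq_triple_iff hf, h]
  have hι' {s t : ℕ → Bool} {l : List ℕ} {i j : Bool} :
      Walk (ι ∘ s) (ι ∘ t) l (ι i) (ι j) ↔ Walk s t l i j := by
    refine ⟨fun hw => ?_, Walk.map ι⟩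
    have := hw.map (Function.invFun ι)
    simpa [← Function.comp_assoc, Function.invFun_comp hι, Function.leftInverse_invFun hι _]
      using this
  -- Trivial labels test the walks; loops at a single vertex test the products.
  refine ⟨fun s t i j => ?_, fun g => ?_⟩
  · simpa [hι'] using hkey (ι ∘ s) (ι ∘ t) (fun _ => 1) (ι i) (ι j) 1
  · have hw (l : List ℕ) : Walk (fun _ => a) (fun _ => a) l a a := Walk.loop (by simp)
    exact (((hkey (fun _ => a) (fun _ => a) g a a _).1 ⟨hw _, rfl⟩).2).symm

/-! ### The basis -/

/-- Append to a plain word a positive version of a group word in which the variable `x` is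
replaced by `x ^ (m + 2)` and its inverse by `x ^ (2 m + 1)`. -/
def appendPositive (m : ℕ) : FreeSemigroup ℕ → List (ℕ × Bool) → FreeSemigroup ℕ
  | u, [] => u
  | u, (x, b) :: L =>
    appendPositive m (u * succPow (FreeSemigroup.of x) (if b then m + 1 else m + m)) L

/-- A plain word that is equal to the group word `w` in groups of exponent dividing `m + 1`. -/
def positiveWord (m : ℕ) (w : FreeGroup ℕ) : FreeSemigroup ℕ :=
  appendPositive m (succPow (FreeSemigroup.of 0) m) w.toWord

theorem pow_add_add_one_eq_inv {G : Type*} [Group G] {m : ℕ} {g : G} (hg : g ^ (m + 1) = 1) :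
    g ^ (m + m + 1) = g⁻¹ := by
  rw [eq_inv_iff_mul_eq_one, ← pow_succ, show m + m + 1 + 1 = (m + 1) + (m + 1) by omega,
    pow_add, hg, one_mul]

theorem pow_letter {G : Type*} [Group G] {m : ℕ} {g : G} (hg : g ^ (m + 1) = 1) (b : Bool) :
    g ^ ((if b then m + 1 else m + m) + 1) = cond b g g⁻¹ := by
  cases b
  · simpa using pow_add_add_one_eq_inv hg
  · simp [pow_succ g (m + 1), hg]

theorem lift_appendPositive {G : Type*} [Group G] {m : ℕ} (hG : ∀ g : G, g ^ (m + 1) = 1)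
    (f : ℕ → G) (L : List (ℕ × Bool)) (u : FreeSemigroup ℕ) :
    FreeSemigroup.lift f (appendPositive m u L) =
      FreeSemigroup.lift f u * FreeGroup.lift f (FreeGroup.mk L) := by
  induction L generalizing u with
  | nil => simp [appendPositive, FreeGroup.lift_mk]
  | cons xb L ih =>
    obtain ⟨x, b⟩ := xb
    rw [appendPositive, ih, map_mul, map_succPow, FreeSemigroup.lift_of, succPow_eq_pow,
      pow_letter (hG _)]
    simp [FreeGroup.lift_mk, mul_assoc]

theorem lift_positiveWord {G : Type*} [Group G] {m : ℕ} (hG : ∀ g : G, g ^ (m + 1) = 1)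
    (f : ℕ → G) (w : FreeGroup ℕ) :
    FreeSemigroup.lift f (positiveWord m w) = FreeGroup.lift f w := by
  rw [positiveWord, lift_appendPositive hG, map_succPow, succPow_eq_pow, hG, one_mul,
    FreeGroup.mk_toWord]

namespace BrandtSemigroup

variable {G I : Type*} [Group G]

theorem lift_appendPositive_of_eq_zero (m : ℕ) (f : ℕ → BrandtSemigroup G I)
    (L : List (ℕ × Bool)) {u : FreeSemigroup ℕ} (hu : FreeSemigroup.lift f u = zero) :
    FreeSemigroup.lift f (appendPositive m u L) = zero := by
  induction L generalizing u with
  | nil => exact hu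
  | cons xb L ih => exact ih (by rw [map_mul, hu, zero_mul'])

/-- For `m > 0` all appended exponents are at least `2`, so a letter outside the maximal subgroup at
`i` makes the word zero. Thus `g` matters only at letters inside it. -/
theorem lift_appendPositive {m : ℕ} (hm : 0 < m) (hG : ∀ g : G, g ^ (m + 1) = 1)
    (f : ℕ → BrandtSemigroup G I) {i : I} {g : ℕ → G}
    (hg : ∀ x c, f x = triple i c i → g x = c) (L : List (ℕ × Bool)) {u : FreeSemigroup ℕ}
    {c : G} (hu : FreeSemigroup.lift f u = triple i c i) :
    FreeSemigroup.lift f (appendPositive m u L) = zero ∨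
      FreeSemigroup.lift f (appendPositive m u L) =
        triple i (c * FreeGroup.lift g (FreeGroup.mk L)) i := by
  induction L generalizing u c with
  | nil => exact Or.inr (by simpa [appendPositive, FreeGroup.lift_mk] using hu)
  | cons xb L ih =>
    obtain ⟨x, b⟩ := xb
    rw [appendPositive]
    rcases eq_zero_or_loop (f x) with h0 | ⟨j, a, ha⟩
    · refine Or.inl (lift_appendPositive_of_eq_zero m f L ?_)
      rw [map_mul, map_succPow, FreeSemigroup.lift_of, h0 _ (by split_ifs <;> omega), mul_zero']
    · by_cases hij : i = j
      · subst hij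
        have h := ih (u := u * succPow (FreeSemigroup.of x) (if b then m + 1 else m + m))
          (c := c * cond b a a⁻¹) (by
            rw [map_mul, map_succPow, FreeSemigroup.lift_of, ha, succPow_triple_same, hu,
              triple_mul_triple_same, pow_letter (hG _)])
        simpa [FreeGroup.lift_mk, hg x a ha, mul_assoc] using h
      · refine Or.inl (lift_appendPositive_of_eq_zero m f L ?_)
        rw [map_mul, map_succPow, FreeSemigroup.lift_of, ha, succPow_triple_same, hu,
          triple_mul_triple_of_ne hij]

/-- The initial power of the variable `0` is zero or `(i, 1, i)`, which fixes the subgroup in which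
the rest is evaluated. -/
theorem positiveWord_mul_self {m : ℕ} (hm : 0 < m) (hG : ∀ g : G, g ^ (m + 1) = 1)
    {w : FreeGroup ℕ} (hw : GroupIdentityHolds w G) :
    PlainIdentity.HoldsIn (positiveWord m w * positiveWord m w, positiveWord m w)
      (BrandtSemigroup G I) := by
  classical
  intro f
  suffices h : FreeSemigroup.lift f (positiveWord m w) = zero ∨
      ∃ i, FreeSemigroup.lift f (positiveWord m w) = triple i 1 i by
    rw [map_mul]
    rcases h with h | ⟨i, h⟩ <;> simp [h]
  rcases eq_zero_or_loop (f 0) with h0 | ⟨i, a, ha⟩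
  · refine Or.inl (lift_appendPositive_of_eq_zero m f _ ?_)
    rw [map_succPow, FreeSemigroup.lift_of, h0 _ hm]
  · have hex (x : ℕ) : ∃ g, ∀ c, f x = triple i c i → g = c := by
      by_cases hx : ∃ c, f x = triple i c i
      · obtain ⟨c, hc⟩ := hx
        exact ⟨c, fun c' hc' => (triple.inj (hc.symm.trans hc')).2.1⟩
      · exact ⟨1, fun c hc => absurd ⟨c, hc⟩ hx⟩
    choose g hg using hex
    refine (lift_appendPositive hm hG f hg w.toWord (c := 1) ?_).imp id fun h => ⟨i, ?_⟩
    · rw [map_succPow, FreeSemigroup.lift_of, ha, succPow_triple_same, hG]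
    · rw [positiveWord, h, FreeGroup.mk_toWord, hw g, one_mul]

end BrandtSemigroup

open FreeSemigroup (of) in
/-- The identities `x² = x ^ (n + 2)`, `x y x = (x y) ^ (n + 1) x`, `x ^ n y ^ n = y ^ n x ^ n`,
where `n = m + 1`, together with `v² = v` for the positive versions `v` of the words in `W`. -/
def brandtBasis (m : ℕ) (W : Set (FreeGroup ℕ)) : Set PlainIdentity :=
  {(of 0 * of 0, succPow (of 0) (m + 2)),
    (of 0 * of 1 * of 0, succPow (of 0 * of 1) (m + 1) * of 0),
    (succPow (of 0) m * succPow (of 1) m, succPow (of 1) m * succPow (of 0) m)} ∪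
  (fun w => (positiveWord m w * positiveWord m w, positiveWord m w)) '' W

theorem brandtBasis_holdsIn {G I : Type*} [Group G] {m : ℕ} (hm : 0 < m)
    (hG : ∀ g : G, g ^ (m + 1) = 1) {W : Set (FreeGroup ℕ)}
    (hW : ∀ w ∈ W, GroupIdentityHolds w G) :
    ∀ d ∈ brandtBasis m W, d.HoldsIn (BrandtSemigroup G I) := by
  open BrandtSemigroup in
  rintro d ((rfl | rfl | rfl) | ⟨w, hw, rfl⟩)
  · intro f
    simp only [map_mul, map_succPow, FreeSemigroup.lift_of]
    rcases eq_zero_or_loop (f 0) with h0 | ⟨i, a, ha⟩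
    · rw [h0 _ (by omega)]
      exact h0 1 one_pos
    · rw [ha, succPow_triple_same, triple_mul_triple_same,
        show m + 2 + 1 = (m + 1) + 2 by omega, pow_add, hG, one_mul, pow_two]
  · intro f
    simp only [map_mul, map_succPow, FreeSemigroup.lift_of]
    rcases h0 : f 0 with _ | ⟨i, a, j⟩
    · simp
    rcases h1 : f 1 with _ | ⟨k, b, l⟩
    · simp
    by_cases hjk : j = k
    · subst hjk
      rw [triple_mul_triple_same]
      by_cases hli : l = i
      · subst hli
        rw [succPow_triple_same, pow_succ, hG, one_mul]
      · rw [triple_mul_triple_of_ne hli, succPow_triple_of_ne (Ne.symm hli) _ (by omega),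
          zero_mul']
    · simp [triple_mul_triple_of_ne hjk]
  · intro f
    simp only [map_mul, map_succPow, FreeSemigroup.lift_of]
    rcases eq_zero_or_loop (f 0) with h0 | ⟨i, a, ha⟩
    · simp [h0 m hm]
    rcases eq_zero_or_loop (f 1) with h1 | ⟨j, b, hb⟩
    · simp [h1 m hm]
    rw [ha, hb, succPow_triple_same, succPow_triple_same, hG, hG]
    by_cases hij : i = j
    · rw [hij]
    · rw [triple_mul_triple_of_ne hij, triple_mul_triple_of_ne (Ne.symm hij)]
  · exact positiveWord_mul_self hm hG (hW w hw)

/-! ### Groups and semigroups satisfying the basis -/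

theorem PlainIdentity.HoldsIn.of_injective {S T : Type*} [Semigroup S] [Semigroup T]
    {d : PlainIdentity} (h : d.HoldsIn T) (φ : S →ₙ* T) (hφ : Function.Injective φ) :
    d.HoldsIn S := fun f => hφ (by
  rw [FreeSemigroup.lift_comp_hom, FreeSemigroup.lift_comp_hom, h])

/-- A group satisfying the basis as a semigroup satisfies the given group identities. -/
theorem groupIdentityHolds_of_brandtBasis {m : ℕ} {W : Set (FreeGroup ℕ)} {H : Type*} [Group H]
    (h : ∀ d ∈ brandtBasis m W, d.HoldsIn H) : ∀ w ∈ W, GroupIdentityHolds w H := by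
  have hexp (a : H) : a ^ (m + 1) = 1 := by
    have := h _ (Or.inl (Or.inl rfl)) fun _ => a
    simp only [map_mul, map_succPow, FreeSemigroup.lift_of, succPow_eq_pow] at this
    rw [show m + 2 + 1 = (m + 1) + 2 by omega, pow_add, ← pow_two] at this
    exact right_eq_mul.1 this
  intro w hw f
  have := h _ (Or.inr ⟨w, hw, rfl⟩) f
  simp only [map_mul, lift_positiveWord hexp] at this
  exact mul_eq_left.1 this

theorem FreeGroup.lift_prod_map_of {K : Type*} [Group K] (g : ℕ → K) (l : List ℕ) :
    FreeGroup.lift g (l.map FreeGroup.of).prod = (l.map g).prod := by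
  rw [map_list_prod, List.map_map]
  congr 2
  funext x
  simp

theorem BrandtEquiv.prod_eq_of_entails {G : Type*} [Group G] {l l' : List ℕ}
    (h : BrandtEquiv G l l') {W : Set (FreeGroup ℕ)} (hW : IsGroupIdentityBasis W G)
    {H : Type} [Group H] (hH : ∀ w ∈ W, GroupIdentityHolds w H) (γ : ℕ → H) :
    (l.map γ).prod = (l'.map γ).prod := by
  have hid : GroupIdentityHolds
      ((l.map FreeGroup.of).prod * ((l'.map FreeGroup.of).prod)⁻¹) G := fun g => by
    rw [map_mul, map_inv, FreeGroup.lift_prod_map_of, FreeGroup.lift_prod_map_of, h.prod_eq g, mul_inv_cancel]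
  have := hW.2 _ hid H hH γ
  rwa [map_mul, map_inv, mul_inv_eq_one, FreeGroup.lift_prod_map_of,
    FreeGroup.lift_prod_map_of] at this

theorem coe_lift_eq_prod {S : Type*} [Semigroup S] (f : ℕ → S) (w : FreeSemigroup ℕ) :
    ((FreeSemigroup.lift f w : S) : WithOne S) =
      ((w.head :: w.tail).map fun x => (f x : WithOne S)).prod := by
  induction w using FreeSemigroup.recOnMul with
  | ih1 x => simp [FreeSemigroup.lift_of, FreeSemigroup.of_head, FreeSemigroup.of_tail]
  | ih2 x w ih1 ih2 =>
    rw [map_mul, WithOne.coe_mul, ih2, FreeSemigroup.lift_of]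
    rfl

section Completeness

variable {S : Type*} [Semigroup S] {m : ℕ} {W : Set (FreeGroup ℕ)}

/-- As `y` may be the adjoined identity, `x² = x ^ (n + 2)` is needed besides `x y x = (x y) ^ (n +
1) x`. -/
theorem isPeriodicLetter_of_brandtBasis (hS : ∀ d ∈ brandtBasis m W, d.HoldsIn S) (a : S) :
    IsPeriodicLetter (m + 1) (a : WithOne S) := by
  intro y
  induction y with
  | one =>
    have := congrArg (WithOne.coe) (hS _ (Or.inl (Or.inl rfl)) fun _ => a)
    simp only [map_mul, map_succPow, FreeSemigroup.lift_of, WithOne.coe_mul, coe_succPow] at this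
    rw [mul_one, this, pow_succ]
  | coe b =>
    have := congrArg (WithOne.coe)
      (hS _ (Or.inl (Or.inr (Or.inl rfl))) fun x => if x = 0 then a else b)
    simpa [map_succPow, coe_succPow] using this

theorem commute_of_brandtBasis (hS : ∀ d ∈ brandtBasis m W, d.HoldsIn S) (e f : WithOne S)
    (he : IsIdempotentElem e) (hf : IsIdempotentElem f) : Commute e f := by
  induction e with
  | one => exact .one_left f
  | coe a =>
    induction f with
    | one => exact .one_right _
    | coe b =>
      have := congrArg (WithOne.coe)
        (hS _ (Or.inl (Or.inr (Or.inr rfl))) fun x => if x = 0 then a else b)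
      change (a : WithOne S) * b = b * a
      simpa [map_succPow, coe_succPow, he.pow_succ_eq, hf.pow_succ_eq] using this

/-- The adjoined identity is no unit of `e M e` when `e ≠ 1`, so the group embeds in `S` and
inherits its identities. -/
theorem LocalUnit.holdsIn_of_ne_one {e : WithOne S} (hne : e ≠ 1) (he : IsIdempotentElem e)
    {d : PlainIdentity} (hd : d.HoldsIn S) :
    letI := LocalUnit.group he
    d.HoldsIn (LocalUnit e) := by
  let := LocalUnit.group he
  have hex (h : LocalUnit e) : ∃ a : S, (a : WithOne S) = h.val := by
    refine WithOne.ne_one_iff_exists.1 fun h1 => hne ?_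
    have := h.left_val
    rwa [h1, mul_one] at this
  choose φ hφ using hex
  refine hd.of_injective ⟨φ, fun g h => ?_⟩ fun g h hgh => LocalUnit.val_injective ?_
  · apply WithOne.coe_injective
    rw [WithOne.coe_mul, hφ, hφ, hφ]
    rfl
  · rw [← hφ, ← hφ]
    exact congrArg _ hgh

end Completeness

theorem corollary2 (G : Type*) [Group G] (hexp : Monoid.ExponentExists G)
    (hbasis : HasFiniteGroupIdentityBasis G) (I : Type*) [Nontrivial I] :
    HasFinitePlainIdentityBasis (BrandtSemigroup G I) := by
  obtain ⟨N, hN, hG⟩ := hexp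
  obtain ⟨W, hfin, hW⟩ := hbasis
  -- Doubling the exponent ensures `m + 1 ≥ 2`, even for trivial `G`.
  obtain ⟨m, hm⟩ : ∃ m, 2 * N = m + 1 := ⟨2 * N - 1, by omega⟩
  have hG' (g : G) : g ^ (m + 1) = 1 := by rw [← hm, mul_comm, pow_mul, hG, one_pow]
  refine ⟨brandtBasis m W, (Set.toFinite _).union (hfin.image _),
    brandtBasis_holdsIn (by omega) hG' hW.1, fun d hd T _ hT f => ?_⟩
  apply WithOne.coe_injective
  rw [coe_lift_eq_prod, coe_lift_eq_prod]
  refine hd.brandtEquiv.prod_map_eq (commute_of_brandtBasis hT) (n := m + 1) (by omega)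
    (fun x => isPeriodicLetter_of_brandtBasis hT (f x)) (fun x y => ?_)
    fun l l' h e hne he γ => ?_
  · induction y with
    | one => simp
    | coe b => rw [← WithOne.coe_mul]; exact WithOne.coe_ne_one
  · let := LocalUnit.group he
    exact h.prod_eq_of_entails hW
      (groupIdentityHolds_of_brandtBasis fun d hd => LocalUnit.holdsIn_of_ne_one hne he (hT d hd))
      γ
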